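/- There is an absolute constant $C>0$ for which the following holds. Let $p,n\ge 1$, $V=\{1,\dots,p\}$, and let $F:2^V\to\mathbb R$ be non-decreasing and submodular with $F(\varnothing)=0$ and $F(\{i\})>0$ for all $i\in V$. Let $f$ be the Lovász extension of $F$, i.e. $f(w)=\sum_{k=1}^p w_{j_k}\big(F(\{j_1,\dots,j_k\})-F(\{j_1,\dots,j_{k-1}\})\big)$ where $w_{j_1}\ge\dots\ge w_{j_p}$; let $\Omega_\infty(\theta)=f(|\theta|)$ with $|\theta|$ the entrywise absolute value, let $|P|(F)=\{s\in\mathbb R^p:\sum_{i\in A}|s_i|\le F(A)\ \forall A\subseteq V\}$, and let $G=\mathbb E_{g\sim\mathcal N(0,I_p)}\sup_{s\in|P|(F)}g^\top s$ be its Gaussian width. Let $l(\theta;(x,y))=\ell(\theta^\top x,y)$ be the loss of a generalized linear model, where $\ell(\cdot,y)$ is $L$-Lipschitz for every $y$, $L>0$. Let $Dist$ be a probability distribution of $d=(x,y)\in\mathbb R^p\times\mathbb R$ with $\|x\|_2\le R_2$ almost surely, $R_2>0$, and $\mathbb E\,|l(\theta;d)|<\infty$ for all $\theta$. Let $\epsilon>0$,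 $0<\delta\le 1$, $0<\alpha<1$ and $$\lambda=\frac{LR_2\sqrt n}{G},\qquad \sigma=\frac{4LR_2\sqrt{\log(1/\delta)+\epsilon}}{\lambda\,\epsilon}.$$ For a sample $D=(d_1,\dots,d_n)$ put $$\mathcal L(\theta;D)=\frac1n\sum_{i=1}^n l(\theta;d_i)+\frac{\lambda}{n}\Omega_\infty(\theta),\qquad J(\theta)=\mathbb E_{d\sim Dist}\Big[l(\theta;d)+\frac{\lambda}{n}\Omega_\infty(\theta)\Big].$$ Let $\Theta\subseteq\mathbb R^p$ (for instance $\Theta=\mathbb R^p$), let $B\in\mathbb R$, and let $\theta^*$ be a minimizer of $J$ over $\Theta$ with $\|\theta^*\|_2\le B$. Then, with probability at least $1-\alpha$ over an i.i.d. sample $D\sim Dist^{\,n}$, the following holds for every minimizer $\hat\theta$ of $\mathcal L(\cdot\,;D)$ over $\Theta$ with $\|\hat\theta\|_2\le B$: the output perturbation $\theta^{priv}=\hat\theta+b$, $b\sim\mathcal N(0,\sigma^2I_p)$, satisfies that $J(\theta^{priv})-J(\theta^*)$ is integrable and $$\mathbb E_b\big[J(\theta^{priv})-J(\theta^*)\big]\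 \le\ K\cdot\frac{LR_2\,G\sqrt{\log(1/\delta)+\epsilon}}{\epsilon\sqrt n},\qquad K=C\left(1+\frac{B\,\epsilon\sqrt{\log(2/\alpha)}}{G\sqrt{\log(1/\delta)+\epsilon}}\right).$$ In particular, for fixed $B,\alpha,\epsilon,\delta$ and $F$ the expected excess true risk is $O\!\big(LR_2G\sqrt{\log(1/\delta)+\epsilon}/(\epsilon\sqrt n)\big)$, with an implied constant that depends neither on $n,L,R_2$ nor on the loss and the distribution. -/

import Mathlib

open MeasureTheory ProbabilityTheory

namespace SparsePrivateERM

noncomputable section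

/-- Submodularity of a real-valued set function on `V = {1, …, p}`. -/
def IsSubmodular {p : ℕ} (F : Finset (Fin p) → ℝ) : Prop :=
  ∀ A B : Finset (Fin p), F (A ∪ B) + F (A ∩ B) ≤ F A + F B

/-- The Lovász extension: if `w (τ 0) ≥ w (τ 1) ≥ …`, it is
`∑ k, w (τ k) * (F {τ 0, …, τ k} - F {τ 0, …, τ (k - 1)})`. -/
def lovaszExtension {p : ℕ} (F : Finset (Fin p) → ℝ) (w : Fin p → ℝ) : ℝ :=
  let τ : Equiv.Perm (Fin p) := Tuple.sort (fun i => -w i)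
  ∑ k : Fin p, w (τ k) * (F ((Finset.Iic k).image τ) - F ((Finset.Iio k).image τ))

/-- The regularizer `Ω_∞(θ) = f(|θ|)`, with `f` the Lovász extension of `F`. -/
def omegaInf {p : ℕ} (F : Finset (Fin p) → ℝ) (θ : EuclideanSpace ℝ (Fin p)) : ℝ :=
  lovaszExtension F (fun i => |θ i|)

/-- The symmetric submodular polyhedron `|P|(F)`. -/
def symPolyhedron {p : ℕ} (F : Finset (Fin p) → ℝ) : Set (EuclideanSpace ℝ (Fin p)) :=
  {s | ∀ A : Finset (Fin p), ∑ i ∈ A, |s i| ≤ F A}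

/-- The Gaussian width `E sup_{w ∈ C} ⟨b, w⟩` with `b ∼ N(0, I_p)`. -/
def gaussianWidth {p : ℕ} (C : Set (EuclideanSpace ℝ (Fin p))) : ℝ :=
  ∫ b, (⨆ w : C, inner ℝ b (w : EuclideanSpace ℝ (Fin p)))
    ∂(stdGaussian (EuclideanSpace ℝ (Fin p)))

/-- The Gaussian law `N(0, σ² I_p)`. -/
def isotropicGaussian (p : ℕ) (σ : ℝ) : Measure (EuclideanSpace ℝ (Fin p)) :=
  (stdGaussian (EuclideanSpace ℝ (Fin p))).map (fun b => σ • b)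

/-- A data point `(x, y)`. -/
abbrev DataPoint (p : ℕ) : Type := EuclideanSpace ℝ (Fin p) × ℝ

/-- The loss `l(θ; (x, y)) = ℓ(θᵀx, y)` of a generalized linear model. -/
def glmLoss {p : ℕ} (ℓ : ℝ → ℝ → ℝ) (θ : EuclideanSpace ℝ (Fin p)) (d : DataPoint p) : ℝ :=
  ℓ (inner ℝ θ d.1) d.2

/-- The regularized empirical risk `(1/n) ∑ l(θ; d_i) + (lam/n) Ω_∞(θ)`. -/
def empRisk {p n : ℕ} (ℓ : ℝ → ℝ → ℝ) (F : Finset (Fin p) → ℝ) (lam : ℝ)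
    (D : Fin n → DataPoint p) (θ : EuclideanSpace ℝ (Fin p)) : ℝ :=
  (1 / (n : ℝ)) * ∑ i, glmLoss ℓ θ (D i) + lam / n * omegaInf F θ

/-- The regularized true risk `J(θ) = E_{d ∼ Dist} [l(θ; d) + (lam/n) Ω_∞(θ)]`. -/
def trueRisk {p : ℕ} (n : ℕ) (ℓ : ℝ → ℝ → ℝ) (F : Finset (Fin p) → ℝ) (lam : ℝ)
    (Dist : Measure (DataPoint p)) (θ : EuclideanSpace ℝ (Fin p)) : ℝ :=
  ∫ d, (glmLoss ℓ θ d + lam / n * omegaInf F θ) ∂Dist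

/-- `θ` is a minimizer of `g` over the domain `Θ`. -/
def IsArgmin {p : ℕ} (g : EuclideanSpace ℝ (Fin p) → ℝ) (Θ : Set (EuclideanSpace ℝ (Fin p)))
    (θ : EuclideanSpace ℝ (Fin p)) : Prop :=
  θ ∈ Θ ∧ ∀ θ' ∈ Θ, g θ ≤ g θ'

end

end SparsePrivateERM

/-! The excess risk splits into a noise part, the mean of `J(θhat + b) - J(θhat)`, and a
generalization part `J(θhat) - J(θstar)`.

For the noise part, `Ω_∞` is the support function of `|P|(F)` (`omegaInf_eq_iSup`). It is therefore
subadditive and its mean over a standard Gaussian is `G`. The loss moves by at most `L |⟨b, x⟩|`,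
whose mean is at most `L σ ‖x‖`. The total cost is at most `L σ R₂ + (lam / n) σ G`
(`integral_trueRisk_add_smul_le`).

For the generalization part, optimality of `θhat` for the empirical risk leaves only the gap between
true and empirical excess loss, which has to be bounded uniformly over the ball of radius `B`
without dependence on `p` (`exists_event_forall_excess_loss_le`). The tool is an exponential moment
bound for the maximum of the centered process (`lintegral_exp_familyMax_sum_centered_le`): Jensen
symmetrizes one observation, contraction replaces the loss by the linear form `⟨w, x⟩`, and the
parallelogram law controls the growth of `cosh ‖·‖` under steps `± x`. Chernoff's inequality gives
the tail for finite classes; monotone unions and density extend it to the ball. -/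

namespace SparsePrivateERM

/-! ### Exponential inequalities -/

/-- Weak majorization of two-term sums of exponentials. -/
lemma exp_add_exp_le_of_weakMajorized {x₁ x₂ y₁ y₂ : ℝ} (hsum : x₁ + x₂ ≤ y₁ + y₂)
    (h₁ : x₁ ≤ max y₁ y₂) (h₂ : x₂ ≤ max y₁ y₂) :
    Real.exp x₁ + Real.exp x₂ ≤ Real.exp y₁ + Real.exp y₂ := by
  wlog hy : y₂ ≤ y₁ generalizing y₁ y₂
  · rw [add_comm (Real.exp y₁)]
    exact this (by linarith) (max_comm y₁ y₂ ▸ h₁) (max_comm y₁ y₂ ▸ h₂) (not_le.1 hy).le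
  wlog hx : x₂ ≤ x₁ generalizing x₁ x₂
  · rw [add_comm (Real.exp x₁)]
    exact this (by linarith) h₂ h₁ (not_le.1 hx).le
  rw [max_eq_left hy] at h₁ h₂
  rcases le_total x₂ y₂ with h | h
  · exact add_le_add (Real.exp_le_exp.2 h₁) (Real.exp_le_exp.2 h)
  -- Remaining case `y₂ ≤ x₂ ≤ x₁ ≤ y₁`: the interval from `x₁` to `y₁` is at least as long as that
  -- from `y₂` to `x₂` and starts higher, so `exp` increases at least as much over it.
  have e₁ : Real.exp y₁ = Real.exp x₁ * Real.exp (y₁ - x₁) := by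
    rw [← Real.exp_add]; congr 1; ring
  have e₂ : Real.exp x₂ = Real.exp y₂ * Real.exp (x₂ - y₂) := by
    rw [← Real.exp_add]; congr 1; ring
  have e₃ : Real.exp (x₂ - y₂) ≤ Real.exp (y₁ - x₁) := Real.exp_le_exp.2 (by linarith)
  have e₄ : Real.exp y₂ ≤ Real.exp x₁ := Real.exp_le_exp.2 (by linarith)
  have e₅ : 1 ≤ Real.exp (x₂ - y₂) := Real.one_le_exp (by linarith)
  have e₆ := mul_le_mul e₄ (sub_le_sub_right e₃ 1) (by linarith) (Real.exp_pos _).le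
  linarith

/-- Karamata's inequality for the convex function `t ^ k`. The induction rests on the identity `h₄`,
which writes the new difference as a sum of nonnegative terms. -/
lemma pow_add_pow_le_of_majorized {a b A B : ℝ} (hB : 0 ≤ B) (hBa : B ≤ a) (hBb : B ≤ b)
    (hsum : a + b = A + B) (k : ℕ) : a ^ k + b ^ k ≤ A ^ k + B ^ k := by
  induction k with
  | zero => simp
  | succ k ih =>
    have hA : a ≤ A := by linarith
    have h₁ : B ^ k ≤ b ^ k := pow_le_pow_left₀ hB hBb k
    have h₂ : a ^ k ≤ A ^ k := pow_le_pow_left₀ (hB.trans hBa) hA k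
    have h₃ : 0 ≤ (A - a) * (A ^ k - b ^ k) := by
      refine mul_nonneg (by linarith) (sub_nonneg.2 (pow_le_pow_left₀ (hB.trans hBb) ?_ k))
      linarith
    have h₄ : A ^ (k + 1) + B ^ (k + 1) - a ^ (k + 1) - b ^ (k + 1)
        = a * (A ^ k + B ^ k - a ^ k - b ^ k) + (A - a) * (A ^ k - b ^ k)
          + (a - B) * (b ^ k - B ^ k) := by
      obtain rfl : b = A + B - a := by linarith
      ring
    have h₅ := mul_nonneg (hB.trans hBa) (sub_nonneg.2 ih)
    have h₆ := mul_nonneg (sub_nonneg.2 hBa) (sub_nonneg.2 h₁)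
    nlinarith

/-- Since `cosh` is a power series in the square of its argument with nonnegative coefficients, the
inequality for powers applies term by term. -/
lemma cosh_add_cosh_le_of_sq_majorized {a b A B : ℝ} (hBa : B ^ 2 ≤ a ^ 2) (hBb : B ^ 2 ≤ b ^ 2)
    (hsum : a ^ 2 + b ^ 2 = A ^ 2 + B ^ 2) :
    Real.cosh a + Real.cosh b ≤ Real.cosh A + Real.cosh B := by
  refine hasSum_le (fun k => ?_) ((Real.hasSum_cosh a).add (Real.hasSum_cosh b))
    ((Real.hasSum_cosh A).add (Real.hasSum_cosh B))
  simp only [pow_mul, ← add_div]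
  exact div_le_div_of_nonneg_right (pow_add_pow_le_of_majorized (sq_nonneg _) hBa hBb hsum k)
    (by positivity)

/-- The function `cosh ‖·‖` on an inner product space grows by a factor of at most `cosh ‖x‖`
under averaging over a step `± x`. -/
lemma cosh_norm_add_add_cosh_norm_sub_le {E : Type*} [NormedAddCommGroup E] [InnerProductSpace ℝ E]
    (c : ℝ) (u x : E) :
    Real.cosh (c * ‖u + x‖) + Real.cosh (c * ‖u - x‖)
      ≤ 2 * (Real.cosh (c * ‖u‖) * Real.cosh (c * ‖x‖)) := by
  -- By the parallelogram law the squares of `‖u ± x‖` and of `‖u‖ ± ‖x‖` have the same sum, and the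
  -- latter pair is the more spread out.
  have h := cosh_add_cosh_le_of_sq_majorized (a := c * ‖u + x‖) (b := c * ‖u - x‖)
    (A := c * ‖u‖ + c * ‖x‖) (B := c * ‖u‖ - c * ‖x‖) ?_ ?_ ?_
  · rw [Real.cosh_add, Real.cosh_sub] at h
    linarith
  · rw [← mul_sub, mul_pow, mul_pow]
    gcongr ?_ * ?_
    rw [sq_le_sq, abs_norm]
    simpa using abs_norm_sub_norm_le u (-x)
  · rw [← mul_sub, mul_pow, mul_pow]
    gcongr ?_ * ?_
    rw [sq_le_sq, abs_norm]
    exact abs_norm_sub_norm_le u x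
  · have := parallelogram_law_with_norm ℝ u x
    linear_combination c ^ 2 * this

/-! ### Maxima of finite families and the contraction principle -/

/-- The maximum of a finite nonempty family of reals. -/
noncomputable def familyMax {ι : Type*} [Fintype ι] [Nonempty ι] (a : ι → ℝ) : ℝ :=
  Finset.univ.sup' Finset.univ_nonempty a

section familyMax

variable {ι : Type*} [Fintype ι] [Nonempty ι]

lemma le_familyMax (a : ι → ℝ) (i : ι) : a i ≤ familyMax a :=
  Finset.le_sup' a (Finset.mem_univ i)

lemma familyMax_le {a : ι → ℝ} {c : ℝ} (h : ∀ i, a i ≤ c) : familyMax a ≤ c :=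
  Finset.sup'_le _ _ fun i _ => h i

lemma exists_familyMax_eq (a : ι → ℝ) : ∃ i, familyMax a = a i := by
  obtain ⟨i, -, hi⟩ := Finset.exists_mem_eq_sup' Finset.univ_nonempty a
  exact ⟨i, hi⟩

lemma measurable_familyMax {X : Type*} [MeasurableSpace X] {a : ι → X → ℝ}
    (ha : ∀ i, Measurable (a i)) : Measurable fun x => familyMax fun i => a i x := by
  have h := Finset.measurable_sup' (f := a) Finset.univ_nonempty fun i _ => ha i
  convert h using 2 with x
  exact (Finset.sup'_apply _ _ _).symm

/-- The contraction principle for one random sign and the exponential function. -/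
lemma exp_familyMax_contraction (a h s : ι → ℝ) (hs : ∀ i, |h i| ≤ |s i|)
    (hd : ∀ i j, |h i - h j| ≤ |s i - s j|) :
    Real.exp (familyMax fun i => a i + h i) + Real.exp (familyMax fun i => a i - h i)
      ≤ Real.exp (familyMax fun i => a i + s i) + Real.exp (familyMax fun i => a i - s i) := by
  obtain ⟨i, hi⟩ := exists_familyMax_eq fun i => a i + h i
  obtain ⟨j, hj⟩ := exists_familyMax_eq fun i => a i - h i
  rw [hi, hj]
  have hp := le_familyMax fun i => a i + s i
  have hm := le_familyMax fun i => a i - s i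
  -- The larger maximum on the right dominates each exponent on the left; the increment condition
  -- `hd` bounds the sum of the two exponents. This is weak majorization.
  have habs : ∀ k, a k + |s k| ≤
      max (familyMax fun i => a i + s i) (familyMax fun i => a i - s i) := by
    intro k
    rcases abs_cases (s k) with ⟨e, -⟩ | ⟨e, -⟩ <;> rw [e]
    · exact le_max_of_le_left (hp k)
    · exact le_max_of_le_right (by simpa [sub_eq_add_neg] using hm k)
  refine exp_add_exp_le_of_weakMajorized ?_ ?_ ?_
  · have h₁ := (le_abs_self _).trans (hd i j)
    have := hp i; have := hp j; have := hm i; have := hm j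
    rcases abs_cases (s i - s j) with ⟨e, -⟩ | ⟨e, -⟩ <;> rw [e] at h₁ <;> linarith
  · linarith [habs i, hs i, le_abs_self (h i)]
  · linarith [habs j, hs j, neg_abs_le (h j)]

end familyMax

/-! ### Exponential moments of suprema of centered empirical processes -/

section ExponentialMoment

variable {ι : Type*} [Fintype ι] [Nonempty ι] {X : Type*} [MeasurableSpace X]
  {E : Type*} [NormedAddCommGroup E] [InnerProductSpace ℝ E]

lemma exp_midpoint_le (x y : ℝ) : Real.exp ((x + y) / 2) ≤ (Real.exp x + Real.exp y) / 2 := by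
  have h := exp_add_exp_le_of_weakMajorized (x₁ := (x + y) / 2) (x₂ := (x + y) / 2) (y₁ := x)
    (y₂ := y) (by linarith) ?_ ?_
  · linarith
  all_goals rcases le_total x y with h | h <;> simp [h] <;> linarith

lemma integrable_exp_familyMax {μ : Measure X} [IsFiniteMeasure μ] {a : ι → X → ℝ} {K : ℝ}
    (ha : ∀ i, Measurable (a i)) (hK : ∀ᵐ d ∂μ, ∀ i, a i d ≤ K) :
    Integrable (fun d => Real.exp (familyMax fun i => a i d)) μ := by
  refine Integrable.of_bound
    (Real.measurable_exp.comp (measurable_familyMax ha)).aestronglyMeasurable (Real.exp K) ?_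
  filter_upwards [hK] with d hd
  rw [Real.norm_eq_abs, Real.abs_exp]
  exact Real.exp_le_exp.2 (familyMax_le hd)

/-- Symmetrization and contraction for a single observation. -/
lemma lintegral_exp_familyMax_centered_le {μ : Measure X} [IsProbabilityMeasure μ]
    {h s : ι → X → ℝ} {K : ℝ} (hh : ∀ i, Measurable (h i))
    (hK : ∀ᵐ d ∂μ, ∀ i, |s i d| ≤ K) (hs : ∀ᵐ d ∂μ, ∀ i, |h i d| ≤ |s i d|)
    (hd : ∀ᵐ d ∂μ, ∀ i j, |h i d - h j d| ≤ |s i d - s j d|) (a : ι → ℝ) :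
    ∫⁻ d, ENNReal.ofReal (Real.exp (familyMax fun i => a i + ((∫ d', h i d' ∂μ) - h i d))) ∂μ
      ≤ ∫⁻ d, ENNReal.ofReal ((Real.exp (familyMax fun i => a i + 2 * s i d)
          + Real.exp (familyMax fun i => a i - 2 * s i d)) / 2) ∂μ := by
  have hhK : ∀ᵐ d ∂μ, ∀ i, |h i d| ≤ K := by
    filter_upwards [hK, hs] with d h₁ h₂ i using (h₂ i).trans (h₁ i)
  have hint : ∀ i, Integrable (h i) μ := fun i =>
    Integrable.of_bound (hh i).aestronglyMeasurable K (hhK.mono fun d hd => hd i)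
  set P : X → ℝ := fun d => Real.exp (familyMax fun i => a i + 2 * h i d) with hP
  set Q : X → ℝ := fun d => Real.exp (familyMax fun i => a i - 2 * h i d) with hQ
  have hPi : Integrable P μ := by
    refine integrable_exp_familyMax (K := familyMax a + 2 * K)
      (fun i => ((hh i).const_mul 2).const_add (a i)) ?_
    filter_upwards [hhK] with d hd i
    linarith [le_familyMax a i, (abs_le.1 (hd i)).2]
  have hQi : Integrable Q μ := by
    refine integrable_exp_familyMax (K := familyMax a + 2 * K)
      (fun i => ((hh i).const_mul 2).const_sub (a i)) ?_
    filter_upwards [hhK] with d hd i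
    linarith [le_familyMax a i, (abs_le.1 (hd i)).1]
  -- Jensen moves the mean over an independent copy `d'` outside `exp`. Midpoint convexity then
  -- separates `d'` from `d`, at the price of the factor 2 in front of `h`.
  have key : ∀ d, Real.exp (familyMax fun i => a i + ((∫ d', h i d' ∂μ) - h i d))
      ≤ ((∫ d', P d' ∂μ) + Q d) / 2 := by
    intro d
    obtain ⟨i, hi⟩ := exists_familyMax_eq fun i => a i + ((∫ d', h i d' ∂μ) - h i d)
    rw [hi]
    have hpt : ∀ d', Real.exp (a i + (h i d' - h i d)) ≤ (P d' + Q d) / 2 := by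
      intro d'
      have h₁ : a i + (h i d' - h i d) = ((a i + 2 * h i d') + (a i - 2 * h i d)) / 2 := by ring
      rw [h₁]
      refine (exp_midpoint_le _ _).trans ?_
      have h₂ := Real.exp_le_exp.2 (le_familyMax (fun i => a i + 2 * h i d') i)
      have h₃ := Real.exp_le_exp.2 (le_familyMax (fun i => a i - 2 * h i d) i)
      simp only [hP, hQ]
      linarith
    have hPQ : Integrable (fun d' => (P d' + Q d) / 2) μ :=
      (hPi.add (integrable_const _)).div_const 2
    have hX : Integrable (fun d' => a i + (h i d' - h i d)) μ :=
      (integrable_const _).add ((hint i).sub (integrable_const _))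
    have hexp : Integrable (fun d' => Real.exp (a i + (h i d' - h i d))) μ := by
      refine hPQ.mono' (Real.measurable_exp.comp
        (((hh i).sub_const _).const_add _)).aestronglyMeasurable ?_
      filter_upwards with d'
      rw [Real.norm_eq_abs, Real.abs_exp]
      exact hpt d'
    have hJ := convexOn_exp.map_integral_le Real.continuous_exp.continuousOn isClosed_univ
      (by simp) hX hexp
    have e₁ : ∫ d', (a i + (h i d' - h i d)) ∂μ = a i + ((∫ d', h i d' ∂μ) - h i d) := by
      have hsub : Integrable (fun d' => h i d' - h i d) μ := (hint i).sub (integrable_const _)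
      rw [integral_add (integrable_const _) hsub, integral_sub (hint i) (integrable_const _)]
      simp
    rw [e₁] at hJ
    refine hJ.trans ((integral_mono hexp hPQ hpt).trans_eq ?_)
    rw [integral_div, integral_add hPi (integrable_const _)]
    simp
  calc _ ≤ ∫⁻ d, ENNReal.ofReal (((∫ d', P d' ∂μ) + Q d) / 2) ∂μ :=
        lintegral_mono fun d => ENNReal.ofReal_le_ofReal (key d)
    _ = ENNReal.ofReal (∫ d, ((∫ d', P d' ∂μ) + Q d) / 2 ∂μ) := by
        have hcQ : Integrable (fun d => ((∫ d', P d' ∂μ) + Q d) / 2) μ :=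
          ((integrable_const _).add hQi).div_const 2
        rw [ofReal_integral_eq_lintegral_ofReal hcQ]
        filter_upwards with d
        have : 0 ≤ ∫ d', P d' ∂μ := integral_nonneg fun _ => (Real.exp_pos _).le
        have : 0 < Q d := Real.exp_pos _
        simp only [Pi.zero_apply]
        positivity
    -- Once separated, the two copies may be merged into one variable. The integrand becomes an
    -- average over a random sign, to which contraction applies pointwise.
    _ = ENNReal.ofReal (∫ d, (P d + Q d) / 2 ∂μ) := by
        rw [integral_div, integral_div, integral_add (integrable_const _) hQi,
          integral_add hPi hQi]
        simp
    _ = ∫⁻ d, ENNReal.ofReal ((P d + Q d) / 2) ∂μ := by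
        have hPQ : Integrable (fun d => (P d + Q d) / 2) μ := (hPi.add hQi).div_const 2
        rw [ofReal_integral_eq_lintegral_ofReal hPQ]
        filter_upwards with d
        have : 0 < P d := Real.exp_pos _
        have : 0 < Q d := Real.exp_pos _
        simp only [Pi.zero_apply]
        positivity
    _ ≤ _ := by
        refine lintegral_mono_ae ?_
        filter_upwards [hs, hd] with d h₁ h₂
        refine ENNReal.ofReal_le_ofReal (div_le_div_of_nonneg_right ?_ (by norm_num))
        refine exp_familyMax_contraction a (fun i => 2 * h i d) (fun i => 2 * s i d) ?_ ?_
        · intro i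
          simpa [abs_mul] using h₁ i
        · intro i j
          rw [← mul_sub, ← mul_sub, abs_mul, abs_mul]
          exact mul_le_mul_of_nonneg_left (h₂ i j) (abs_nonneg _)

/-- A dimension-free bound on the exponential moment of the maximum of a centered empirical process
whose increments are dominated by those of a bounded linear process. -/
lemma lintegral_exp_familyMax_sum_centered_le [MeasurableSpace E] [BorelSpace E]
    {μ : Measure X} [IsProbabilityMeasure μ]
    {h : ι → X → ℝ} {x : X → E} {w : ι → E} {ρ R : ℝ} (hρ : 0 ≤ ρ)
    (hh : ∀ i, Measurable (h i)) (hx : Measurable x)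
    (hw : ∀ i, ‖w i‖ ≤ ρ) (hR : ∀ᵐ d ∂μ, ‖x d‖ ≤ R)
    (hs : ∀ᵐ d ∂μ, ∀ i, |h i d| ≤ |inner ℝ (w i) (x d)|)
    (hd : ∀ᵐ d ∂μ, ∀ i j, |h i d - h j d| ≤ |inner ℝ (w i - w j) (x d)|) (n : ℕ) (u : E) :
    ∫⁻ D, ENNReal.ofReal (Real.exp (familyMax fun i => 2 * inner ℝ (w i) u
        + ∑ k, ((∫ d', h i d' ∂μ) - h i (D k)))) ∂(Measure.pi fun _ : Fin n => μ)
      ≤ ENNReal.ofReal (2 * Real.cosh (2 * ρ * ‖u‖) * Real.cosh (2 * ρ * R) ^ n) := by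
  -- The vector `u` accumulates the signed steps `± x d` of the observations already symmetrized, so
  -- it must stay free in the induction.
  induction n generalizing u with
  | zero =>
    simp only [Finset.univ_eq_empty, Finset.sum_empty, add_zero, lintegral_const, measure_univ,
      mul_one, pow_zero]
    refine ENNReal.ofReal_le_ofReal ?_
    have h₁ : familyMax (fun i => 2 * inner ℝ (w i) u) ≤ 2 * ρ * ‖u‖ := by
      refine familyMax_le fun i => ?_
      have := real_inner_le_norm (w i) u
      have := mul_le_mul_of_nonneg_right (hw i) (norm_nonneg u)
      linarith
    have h₂ := Real.exp_le_exp.2 h₁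
    have h₃ := Real.exp_pos (-(2 * ρ * ‖u‖))
    rw [Real.cosh_eq]
    linarith
  | succ n ih =>
    have hK : ∀ᵐ d ∂μ, ∀ i, |inner ℝ (w i) (x d)| ≤ ρ * R := by
      filter_upwards [hR] with d hd i
      exact (abs_real_inner_le_norm _ _).trans
        (mul_le_mul (hw i) hd (norm_nonneg _) hρ)
    have hmeas : ∀ (m : ℕ) (i : ι), Measurable fun D : Fin m → X =>
        ∑ k, ((∫ d', h i d' ∂μ) - h i (D k)) := fun m i =>
      Finset.measurable_sum _ fun k _ => ((hh i).comp (measurable_pi_apply k)).const_sub _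
    have hin : ∀ i, Measurable fun d => inner ℝ (w i) (x d) := fun i =>
      (innerSL ℝ (w i)).continuous.measurable.comp hx
    set A : E → (Fin n → X) → ι → ℝ := fun u D i => 2 * inner ℝ (w i) u
      + ∑ k, ((∫ d', h i d' ∂μ) - h i (D k)) with hA
    have hsplit := (measurePreserving_piFinSuccAbove
      (fun _ : Fin (n + 1) => μ) 0).symm.lintegral_comp_emb
      (MeasurableEquiv.measurableEmbedding _)
      (fun D => ENNReal.ofReal (Real.exp (familyMax fun i => 2 * inner ℝ (w i) u
        + ∑ k, ((∫ d', h i d' ∂μ) - h i (D k)))))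
    rw [← hsplit]
    have hform : ∀ z : X × (Fin n → X), (familyMax fun i => 2 * inner ℝ (w i) u
        + ∑ k, ((∫ d', h i d' ∂μ) -
          h i ((MeasurableEquiv.piFinSuccAbove (fun _ : Fin (n + 1) => X) 0).symm z k)))
        = familyMax fun i => A u z.2 i + ((∫ d', h i d' ∂μ) - h i z.1) := by
      intro z
      congr 1
      ext i
      simp [hA, Fin.sum_univ_succ, MeasurableEquiv.piFinSuccAbove]
      ring
    simp only [hform]
    rw [lintegral_prod_symm' _ (by
      refine (Real.measurable_exp.comp (measurable_familyMax fun i => ?_)).ennreal_ofReal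
      exact ((((hmeas n i).comp measurable_snd).const_add _).add
        (((hh i).comp measurable_fst).const_sub _)))]
    calc _ ≤ ∫⁻ D, ∫⁻ d, ENNReal.ofReal (
            (Real.exp (familyMax fun i => A u D i + 2 * inner ℝ (w i) (x d))
            + Real.exp (familyMax fun i => A u D i - 2 * inner ℝ (w i) (x d))) / 2) ∂μ
            ∂(Measure.pi fun _ : Fin n => μ) := by
          refine lintegral_mono fun D => ?_
          refine lintegral_exp_familyMax_centered_le hh hK hs ?_ (A u D)
          simpa only [inner_sub_left] using hd
      -- The term `± 2 ⟨w i, x d⟩` is absorbed by moving `u` to `u ± x d`. With `d` frozen, the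
      -- integral over the other observations falls under the induction hypothesis.
      _ = ∫⁻ d, ∫⁻ D, ENNReal.ofReal (
            (Real.exp (familyMax (A (u + x d) D)) + Real.exp (familyMax (A (u - x d) D))) / 2)
            ∂(Measure.pi fun _ : Fin n => μ) ∂μ := by
          rw [lintegral_lintegral_swap]
          · have hadd : ∀ D d, (fun i => A u D i + 2 * inner ℝ (w i) (x d)) = A (u + x d) D := by
              intro D d
              ext i
              simp only [hA, inner_add_right]
              ring
            have hsub : ∀ D d, (fun i => A u D i - 2 * inner ℝ (w i) (x d)) = A (u - x d) D := by
              intro D d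
              ext i
              simp only [hA, inner_sub_right]
              ring
            simp only [hadd, hsub]
          · refine (((Real.measurable_exp.comp (measurable_familyMax fun i => ?_)).add
              (Real.measurable_exp.comp
                (measurable_familyMax fun i => ?_))).div_const 2).ennreal_ofReal.aemeasurable
            · exact (((hmeas n i).comp measurable_fst).const_add _).add
                (((hin i).comp measurable_snd).const_mul _)
            · exact (((hmeas n i).comp measurable_fst).const_add _).sub
                (((hin i).comp measurable_snd).const_mul _)
      _ ≤ ∫⁻ _, ENNReal.ofReal (2 * Real.cosh (2 * ρ * ‖u‖) * Real.cosh (2 * ρ * R) ^ (n + 1))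
            ∂μ := by
          refine lintegral_mono_ae ?_
          filter_upwards [hR] with d hd
          have hm : ∀ v : E, Measurable fun D => ENNReal.ofReal (Real.exp (familyMax (A v D))) :=
            fun v => (Real.measurable_exp.comp (measurable_familyMax fun i =>
              ((hmeas n i).const_add _))).ennreal_ofReal
          have h₁ : ∀ D, ENNReal.ofReal (
              (Real.exp (familyMax (A (u + x d) D)) + Real.exp (familyMax (A (u - x d) D))) / 2)
              = ENNReal.ofReal (1 / 2) * (ENNReal.ofReal (Real.exp (familyMax (A (u + x d) D)))
                + ENNReal.ofReal (Real.exp (familyMax (A (u - x d) D)))) := by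
            intro D
            rw [← ENNReal.ofReal_add (Real.exp_pos _).le (Real.exp_pos _).le,
              ← ENNReal.ofReal_mul (by norm_num)]
            congr 1
            ring
          simp only [h₁]
          rw [lintegral_const_mul' _ _ ENNReal.ofReal_ne_top, lintegral_add_left (hm _)]
          refine (mul_le_mul_right (add_le_add (ih (u + x d)) (ih (u - x d))) _).trans ?_
          have hc : ∀ r : ℝ, 0 < Real.cosh r := Real.cosh_pos
          have hc' : ∀ r : ℝ, 0 ≤ 2 * Real.cosh r * Real.cosh (2 * ρ * R) ^ n := fun r =>
            (mul_pos (mul_pos two_pos (hc r)) (pow_pos (hc _) n)).le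
          rw [← ENNReal.ofReal_add (hc' _) (hc' _), ← ENNReal.ofReal_mul (by norm_num)]
          refine ENNReal.ofReal_le_ofReal ?_
          have h₂ := cosh_norm_add_add_cosh_norm_sub_le (2 * ρ) u (x d)
          have h₃ : Real.cosh (2 * ρ * ‖x d‖) ≤ Real.cosh (2 * ρ * R) := by
            rw [Real.cosh_le_cosh, abs_of_nonneg (by positivity),
              abs_of_nonneg (mul_nonneg (by positivity) ((norm_nonneg _).trans hd))]
            gcongr
          have h₄ := mul_le_mul_of_nonneg_left h₃ (hc (2 * ρ * ‖u‖)).le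
          have h₅ : (0 : ℝ) ≤ Real.cosh (2 * ρ * R) ^ n := (pow_pos (hc _) n).le
          have h₆ := mul_le_mul_of_nonneg_right
            (h₂.trans (mul_le_mul_of_nonneg_left h₄ two_pos.le)) h₅
          rw [pow_succ]
          linarith
      _ = _ := by simp

end ExponentialMoment

/-! ### Uniform deviation bounds -/

section Deviation

variable {X : Type*} [MeasurableSpace X] {E : Type*} [NormedAddCommGroup E]
  [InnerProductSpace ℝ E] [MeasurableSpace E] [BorelSpace E]

/-- Uniform deviations over a finite class. -/
lemma measure_lt_familyMax_sum_centered_le {ι : Type*} [Fintype ι] [Nonempty ι]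
    {μ : Measure X} [IsProbabilityMeasure μ]
    {h : ι → X → ℝ} {x : X → E} {v : ι → E} {L ρ R : ℝ} (hL : 0 < L) (hρ : 0 < ρ) (hR₀ : 0 < R)
    (hh : ∀ i, Measurable (h i)) (hx : Measurable x)
    (hv : ∀ i, ‖v i‖ ≤ ρ) (hR : ∀ᵐ d ∂μ, ‖x d‖ ≤ R)
    (hs : ∀ᵐ d ∂μ, ∀ i, |h i d| ≤ L * |inner ℝ (v i) (x d)|)
    (hd : ∀ᵐ d ∂μ, ∀ i j, |h i d - h j d| ≤ L * |inner ℝ (v i - v j) (x d)|)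
    {n : ℕ} (hn : 0 < n) {α w : ℝ} (hα : 0 < α) (hw₀ : 0 < w)
    (hw : w ^ 2 = 8 * n * (L * ρ * R) ^ 2 * Real.log (2 / α)) :
    (Measure.pi fun _ : Fin n => μ)
        {D | w < familyMax fun i => ∑ k, ((∫ d', h i d' ∂μ) - h i (D k))} ≤ ENNReal.ofReal α := by
  have hN : 0 < L * ρ * R := by positivity
  have hn' : (0 : ℝ) < n := by exact_mod_cast hn
  -- The minimizer of the Chernoff exponent `2 n (t L ρ R)² - t w`. With it the moment is at most `2
  -- * (2 / α)` and `exp (t w) = (2 / α)²`, whose quotient is `α`.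
  obtain ⟨t, ht⟩ : ∃ t, t = w / (4 * n * (L * ρ * R) ^ 2) := ⟨_, rfl⟩
  have ht₀ : 0 < t := by rw [ht]; positivity
  have hmom := lintegral_exp_familyMax_sum_centered_le (μ := μ) (h := fun i d => t * h i d)
    (x := x) (w := fun i => (t * L) • v i) (ρ := t * L * ρ) (R := R) (by positivity)
    (fun i => (hh i).const_mul t) hx
    (fun i => by
      rw [norm_smul, Real.norm_of_nonneg (by positivity)]
      exact mul_le_mul_of_nonneg_left (hv i) (by positivity)) hR
    (by
      filter_upwards [hs] with d hd i
      rw [real_inner_smul_left, abs_mul, abs_mul, abs_of_pos ht₀, abs_of_pos (mul_pos ht₀ hL),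
        mul_assoc]
      exact mul_le_mul_of_nonneg_left (hd i) ht₀.le)
    (by
      filter_upwards [hd] with d hd i j
      rw [← mul_sub, ← smul_sub, real_inner_smul_left, abs_mul, abs_mul, abs_of_pos ht₀,
        abs_of_pos (mul_pos ht₀ hL), mul_assoc]
      exact mul_le_mul_of_nonneg_left (hd i j) ht₀.le) n 0
  simp only [inner_zero_right, mul_zero, zero_add, norm_zero, Real.cosh_zero, mul_one,
    integral_const_mul, ← mul_sub, ← Finset.mul_sum] at hmom
  set S : (Fin n → X) → ι → ℝ := fun D i => ∑ k, ((∫ d', h i d' ∂μ) - h i (D k)) with hS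
  have hSm : ∀ i, Measurable fun D => S D i := fun i =>
    Finset.measurable_sum _ fun k _ => ((hh i).comp (measurable_pi_apply k)).const_sub _
  set Y : (Fin n → X) → ENNReal := fun D =>
    ENNReal.ofReal (Real.exp (familyMax fun i => t * S D i)) with hY
  have hYm : Measurable Y := (Real.measurable_exp.comp
    (measurable_familyMax fun i => (hSm i).const_mul t)).ennreal_ofReal
  have hsub : {D | w < familyMax (S D)} ⊆ {D | ENNReal.ofReal (Real.exp (t * w)) ≤ Y D} := by
    intro D hD
    obtain ⟨i, hi⟩ := exists_familyMax_eq (S D)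
    have hD' : w < S D i := hi ▸ hD
    refine ENNReal.ofReal_le_ofReal (Real.exp_le_exp.2 ?_)
    exact (mul_le_mul_of_nonneg_left hD'.le ht₀.le).trans (le_familyMax (fun i => t * S D i) i)
  refine (measure_mono hsub).trans ?_
  have hpos : ENNReal.ofReal (Real.exp (t * w)) ≠ 0 := by
    simpa using Real.exp_pos (t * w)
  refine (meas_ge_le_lintegral_div hYm.aemeasurable hpos ENNReal.ofReal_ne_top).trans ?_
  rw [ENNReal.div_le_iff hpos ENNReal.ofReal_ne_top, ← ENNReal.ofReal_mul hα.le]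
  refine hmom.trans (ENNReal.ofReal_le_ofReal ?_)
  have h₁ : Real.cosh (2 * (t * L * ρ) * R) ^ n
      ≤ Real.exp (n * ((2 * (t * L * ρ) * R) ^ 2 / 2)) := by
    rw [Real.exp_nat_mul]
    exact pow_le_pow_left₀ (Real.cosh_pos _).le (Real.cosh_le_exp_half_sq _) n
  have h₂ : n * ((2 * (t * L * ρ) * R) ^ 2 / 2) = Real.log (2 / α) := by
    have : n * ((2 * (t * L * ρ) * R) ^ 2 / 2) = w ^ 2 / (8 * n * (L * ρ * R) ^ 2) := by
      rw [ht]; field_simp; norm_num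
    rw [this, hw]
    field_simp
  have h₃ : t * w = Real.log (2 / α) + Real.log (2 / α) := by
    have : t * w = w ^ 2 / (4 * n * (L * ρ * R) ^ 2) := by
      rw [ht]; field_simp
    rw [this, hw]
    field_simp
    ring
  have h₄ : Real.exp (Real.log (2 / α)) = 2 / α := Real.exp_log (by positivity)
  rw [h₂, h₄] at h₁
  rw [h₃, Real.exp_add, h₄]
  calc 2 * Real.cosh (2 * (t * L * ρ) * R) ^ n ≤ 2 * (2 / α) := by linarith
    _ = α * (2 / α * (2 / α)) := by field_simp

/-- Uniform deviations over a countable class. -/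
lemma measure_exists_lt_sum_centered_le {μ : Measure X} [IsProbabilityMeasure μ]
    {h : ℕ → X → ℝ} {x : X → E} {v : ℕ → E} {L ρ R : ℝ} (hL : 0 < L) (hρ : 0 < ρ) (hR₀ : 0 < R)
    (hh : ∀ i, Measurable (h i)) (hx : Measurable x)
    (hv : ∀ i, ‖v i‖ ≤ ρ) (hR : ∀ᵐ d ∂μ, ‖x d‖ ≤ R)
    (hs : ∀ᵐ d ∂μ, ∀ i, |h i d| ≤ L * |inner ℝ (v i) (x d)|)
    (hd : ∀ᵐ d ∂μ, ∀ i j, |h i d - h j d| ≤ L * |inner ℝ (v i - v j) (x d)|)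
    {n : ℕ} (hn : 0 < n) {α w : ℝ} (hα : 0 < α) (hw₀ : 0 < w)
    (hw : w ^ 2 = 8 * n * (L * ρ * R) ^ 2 * Real.log (2 / α)) :
    (Measure.pi fun _ : Fin n => μ)
        {D | ∃ i, w < ∑ k, ((∫ d', h i d' ∂μ) - h i (D k))} ≤ ENNReal.ofReal α := by
  set S : (Fin n → X) → ℕ → ℝ := fun D i => ∑ k, ((∫ d', h i d' ∂μ) - h i (D k)) with hS
  -- The finite bound does not depend on the number of functions, so it survives an increasing
  -- union.
  have hU : {D | ∃ i, w < S D i} = ⋃ N : ℕ, {D | ∃ i : Fin (N + 1), w < S D i} := by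
    ext D
    simp only [Set.mem_ofPred_eq, Set.mem_iUnion]
    exact ⟨fun ⟨i, hi⟩ => ⟨i, ⟨i, i.lt_succ_self⟩, hi⟩, fun ⟨_, i, hi⟩ => ⟨i, hi⟩⟩
  have hmono : Monotone fun N : ℕ => {D | ∃ i : Fin (N + 1), w < S D i} := by
    intro M N hMN D ⟨i, hi⟩
    exact ⟨⟨i, i.2.trans_le (by lia)⟩, hi⟩
  rw [hU, hmono.measure_iUnion]
  refine iSup_le fun N => ?_
  refine (measure_mono ?_).trans (measure_lt_familyMax_sum_centered_le (ι := Fin (N + 1))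
    (h := fun i => h i) (v := fun i => v i) hL hρ hR₀ (fun i => hh i) hx (fun i => hv i) hR
    (hs.mono fun d hd i => hd i) (hd.mono fun d hd i j => hd i j) hn hα hw₀ hw)
  rintro D ⟨i, hi⟩
  exact lt_of_lt_of_le hi (le_familyMax (fun i : Fin (N + 1) => S D i) i)

end Deviation

/-! ### Uniform deviations of generalized linear losses over a Euclidean ball. -/

section GeneralizedLinearModel

variable {p : ℕ} {ℓ : ℝ → ℝ → ℝ} {L R₂ : ℝ} {Dist : Measure (DataPoint p)}

lemma abs_glmLoss_sub_le (hℓ : ∀ y u v, |ℓ u y - ℓ v y| ≤ L * |u - v|)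
    (θ θ' : EuclideanSpace ℝ (Fin p)) (d : DataPoint p) :
    |glmLoss ℓ θ d - glmLoss ℓ θ' d| ≤ L * |inner ℝ (θ - θ') d.1| := by
  rw [inner_sub_left]
  exact hℓ _ _ _

lemma continuous_glmLoss (hL : 0 < L) (hℓ : ∀ y u v, |ℓ u y - ℓ v y| ≤ L * |u - v|)
    (d : DataPoint p) : Continuous fun θ => glmLoss ℓ θ d := by
  have h : LipschitzWith ⟨L, hL.le⟩ fun u => ℓ u d.2 :=
    LipschitzWith.of_dist_le_mul fun u v => by
      rw [Real.dist_eq, Real.dist_eq]; exact hℓ _ _ _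
  exact h.continuous.comp (by fun_prop)

lemma integral_glmLoss_sub_le (hL : 0 < L) (hℓ : ∀ y u v, |ℓ u y - ℓ v y| ≤ L * |u - v|)
    [IsProbabilityMeasure Dist] (hR : ∀ᵐ d ∂Dist, ‖d.1‖ ≤ R₂)
    (hint : ∀ θ, Integrable (glmLoss ℓ θ) Dist) (θ θ' : EuclideanSpace ℝ (Fin p)) :
    |(∫ d, glmLoss ℓ θ d ∂Dist) - ∫ d, glmLoss ℓ θ' d ∂Dist| ≤ L * R₂ * ‖θ - θ'‖ := by
  rw [← integral_sub (hint θ) (hint θ')]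
  have h := norm_integral_le_of_norm_le_const (μ := Dist) (C := L * R₂ * ‖θ - θ'‖)
    (f := fun d => glmLoss ℓ θ d - glmLoss ℓ θ' d) ?_
  · simpa using h
  · filter_upwards [hR] with d hd
    refine (abs_glmLoss_sub_le hℓ θ θ' d).trans ?_
    rw [mul_assoc]
    refine mul_le_mul_of_nonneg_left ((abs_real_inner_le_norm _ _).trans ?_) hL.le
    rw [mul_comm R₂]
    exact mul_le_mul_of_nonneg_left hd (norm_nonneg _)

lemma continuous_integral_glmLoss (hL : 0 < L) (hR₂ : 0 < R₂)
    (hℓ : ∀ y u v, |ℓ u y - ℓ v y| ≤ L * |u - v|)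
    [IsProbabilityMeasure Dist] (hR : ∀ᵐ d ∂Dist, ‖d.1‖ ≤ R₂)
    (hint : ∀ θ, Integrable (glmLoss ℓ θ) Dist) :
    Continuous fun θ => ∫ d, glmLoss ℓ θ d ∂Dist := by
  have h : LipschitzWith ⟨L * R₂, by positivity⟩ fun θ => ∫ d, glmLoss ℓ θ d ∂Dist :=
    LipschitzWith.of_dist_le_mul fun θ θ' => by
      rw [Real.dist_eq, dist_eq_norm]; exact integral_glmLoss_sub_le hL hℓ hR hint θ θ'
  exact h.continuous

/-- With high probability, the empirical excess loss over `θ₀` controls the expected one, uniformly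
over a Euclidean ball and with a dimension-free error. -/
lemma exists_event_forall_excess_loss_le (hL : 0 < L) (hR₂ : 0 < R₂)
    (hℓ : ∀ y u v, |ℓ u y - ℓ v y| ≤ L * |u - v|)
    [IsProbabilityMeasure Dist] (hR : ∀ᵐ d ∂Dist, ‖d.1‖ ≤ R₂)
    (hint : ∀ θ, Integrable (glmLoss ℓ θ) Dist) {n : ℕ} (hn : 0 < n) {α B : ℝ}
    (hα : 0 < α) (hα₁ : α < 1) {θ₀ : EuclideanSpace ℝ (Fin p)} (hθ₀ : ‖θ₀‖ ≤ B) :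
    ∃ E : Set (Fin n → DataPoint p), MeasurableSet E ∧
      ENNReal.ofReal (1 - α) ≤ Measure.pi (fun _ : Fin n => Dist) E ∧
      ∀ D ∈ E, ∀ θ, ‖θ‖ ≤ B →
        (∫ d, glmLoss ℓ θ d ∂Dist) - (∫ d, glmLoss ℓ θ₀ d ∂Dist)
          - 1 / (n : ℝ) * (∑ i, glmLoss ℓ θ (D i) - ∑ i, glmLoss ℓ θ₀ (D i))
          ≤ 6 * (L * R₂ * B * √(Real.log (2 / α)) / √n) := by
  have hB₀ : 0 ≤ B := (norm_nonneg _).trans hθ₀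
  have hn' : (0 : ℝ) < n := by exact_mod_cast hn
  have hlog : 0 < Real.log (2 / α) := Real.log_pos (by rw [lt_div_iff₀ hα]; linarith)
  -- A ball of radius zero is treated apart because the tail bound needs a positive radius and
  -- threshold.
  rcases hB₀.eq_or_lt with rfl | hB
  · refine ⟨Set.univ, MeasurableSet.univ, ?_, fun D _ θ hθ => ?_⟩
    · rw [measure_univ, ENNReal.ofReal_le_one]
      linarith
    · rw [norm_le_zero_iff] at hθ hθ₀
      simp [hθ, hθ₀]
  have : Nonempty (Metric.closedBall (0 : EuclideanSpace ℝ (Fin p)) B) :=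
    ⟨⟨0, Metric.mem_closedBall_self hB₀⟩⟩
  set q : ℕ → Metric.closedBall (0 : EuclideanSpace ℝ (Fin p)) B :=
    TopologicalSpace.denseSeq _ with hq
  have hqB : ∀ i, ‖(q i : EuclideanSpace ℝ (Fin p))‖ ≤ B := fun i =>
    mem_closedBall_zero_iff.1 (q i).2
  have hint' : ∀ i, Integrable (fun d => glmLoss ℓ (q i) d - glmLoss ℓ θ₀ d) Dist := fun i =>
    (hint _).sub (hint _)
  -- Integrability only makes the losses almost everywhere measurable. Measurable versions are used,
  -- and the null set `Z` of samples where they differ from the losses is removed from the event.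
  set h : ℕ → DataPoint p → ℝ := fun i => (hint' i).1.mk _ with hh
  have hhm : ∀ i, Measurable (h i) := fun i => (hint' i).1.stronglyMeasurable_mk.measurable
  have hhe : ∀ᵐ d ∂Dist, ∀ i, glmLoss ℓ (q i) d - glmLoss ℓ θ₀ d = h i d :=
    ae_all_iff.2 fun i => (hint' i).1.ae_eq_mk
  have hhint : ∀ i, ∫ d, h i d ∂Dist
      = (∫ d, glmLoss ℓ (q i) d ∂Dist) - ∫ d, glmLoss ℓ θ₀ d ∂Dist := fun i => by
    rw [← integral_sub (hint _) (hint _)]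
    exact (integral_congr_ae (hhe.mono fun d hd => hd i)).symm
  set w : ℝ := √(8 * n * (L * (2 * B) * R₂) ^ 2 * Real.log (2 / α)) with hw
  have hw₀ : 0 < w := Real.sqrt_pos.2 (by positivity)
  have htail := measure_exists_lt_sum_centered_le (μ := Dist) (h := h) (x := Prod.fst)
    (v := fun i => (q i : EuclideanSpace ℝ (Fin p)) - θ₀) (ρ := 2 * B) hL (by positivity) hR₂
    hhm measurable_fst
    (fun i => (norm_sub_le _ _).trans (by linarith [hqB i])) hR
    (by
      filter_upwards [hhe] with d hd i
      rw [← hd i]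
      exact abs_glmLoss_sub_le hℓ _ _ d)
    (by
      filter_upwards [hhe] with d hd i j
      rw [← hd i, ← hd j, sub_sub_sub_cancel_right, sub_sub_sub_cancel_right]
      exact abs_glmLoss_sub_le hℓ _ _ d) hn hα hw₀ (Real.sq_sqrt (by positivity))
  set bad := {D : Fin n → DataPoint p | ∃ i, w < ∑ k, ((∫ d', h i d' ∂Dist) - h i (D k))}
    with hbad
  have hbadm : MeasurableSet bad := by
    simp only [hbad, Set.ofPred_exists]
    exact MeasurableSet.iUnion fun i => measurableSet_lt measurable_const
      (Finset.measurable_sum _ fun k _ => ((hhm i).comp (measurable_pi_apply k)).const_sub _)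
  have hgood : ∀ᵐ D ∂(Measure.pi fun _ : Fin n => Dist),
      ∀ k i, glmLoss ℓ (q i) (D k) - glmLoss ℓ θ₀ (D k) = h i (D k) :=
    ae_all_iff.2 fun k => (Measure.quasiMeasurePreserving_eval (fun _ : Fin n => Dist) k).ae hhe
  obtain ⟨Z, hZsub, hZm, hZ⟩ := exists_measurable_superset_of_null hgood
  refine ⟨badᶜ ∩ Zᶜ, hbadm.compl.inter hZm.compl, ?_, ?_⟩
  · have h₁ : (Measure.pi fun _ : Fin n => Dist) (badᶜ ∩ Zᶜ)
        = (Measure.pi fun _ : Fin n => Dist) badᶜ :=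
      measure_inter_conull (by simpa using hZ)
    rw [h₁, prob_compl_eq_one_sub hbadm, ENNReal.ofReal_sub _ hα.le, ENNReal.ofReal_one]
    exact tsub_le_tsub_left htail 1
  rintro D ⟨hD₁, hD₂⟩
  have hDe : ∀ k i, glmLoss ℓ (q i) (D k) - glmLoss ℓ θ₀ (D k) = h i (D k) := by
    by_contra hcon
    exact hD₂ (hZsub hcon)
  have hDw : ∀ i, ∑ k, ((∫ d', h i d' ∂Dist) - h i (D k)) ≤ w := by
    simpa [hbad] using hD₁
  set dev : EuclideanSpace ℝ (Fin p) → ℝ := fun θ =>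
    (∫ d, glmLoss ℓ θ d ∂Dist) - (∫ d, glmLoss ℓ θ₀ d ∂Dist)
          - 1 / (n : ℝ) * (∑ i, glmLoss ℓ θ (D i) - ∑ i, glmLoss ℓ θ₀ (D i)) with hdev
  have hcont : Continuous dev := by
    refine ((continuous_integral_glmLoss hL hR₂ hℓ hR hint).sub continuous_const).sub
      (continuous_const.mul (Continuous.sub ?_ continuous_const))
    exact continuous_finsetSum _ fun i _ => continuous_glmLoss hL hℓ (D i)
  have hdevq : ∀ i, dev (q i) ≤ w / n := by
    intro i
    have h₁ := hDw i
    rw [Finset.sum_sub_distrib, Finset.sum_const, Finset.card_univ, Fintype.card_fin,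
      nsmul_eq_mul, hhint] at h₁
    simp only [← hDe, Finset.sum_sub_distrib] at h₁
    rw [le_div_iff₀ hn', hdev]
    refine le_trans (le_of_eq ?_) h₁
    field_simp
  have hall : ∀ z : Metric.closedBall (0 : EuclideanSpace ℝ (Fin p)) B, dev z ≤ w / n := by
    have hcl : IsClosed {z : Metric.closedBall (0 : EuclideanSpace ℝ (Fin p)) B |
        dev z ≤ w / n} := isClosed_le (hcont.comp continuous_subtype_val) continuous_const
    intro z
    have hdense : DenseRange q := TopologicalSpace.denseRange_denseSeq _
    exact hdense.induction_on (p := fun z => dev z ≤ w / n) z hcl hdevq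
  intro θ hθ
  refine (hall ⟨θ, mem_closedBall_zero_iff.2 hθ⟩).trans ?_
  have hsn : 0 < √(n : ℝ) := Real.sqrt_pos.2 hn'
  -- The radius `2 * B` of the differences gives `8 * 2² = 32 ≤ 6²`.
  have hw₁ : w ≤ 6 * (L * R₂ * B) * √(Real.log (2 / α)) * √n := by
    rw [hw]
    refine Real.sqrt_le_iff.2 ⟨by positivity, ?_⟩
    rw [mul_pow _ √(n : ℝ), mul_pow _ √(Real.log (2 / α)), Real.sq_sqrt hlog.le, Real.sq_sqrt hn'.le]
    have : 0 ≤ n * (L * B * R₂) ^ 2 * Real.log (2 / α) := by positivity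
    nlinarith
  rw [div_le_iff₀ hn']
  refine hw₁.trans (le_of_eq ?_)
  rw [mul_assoc 6 _ (n : ℝ), div_mul_eq_mul_div, mul_div_assoc, Real.div_sqrt]
  ring

end GeneralizedLinearModel

/-! ### The regularizer as the support function of the symmetric submodular polyhedron -/

/-- Abel summation: the partial sum is at least its boundary term `W n * T n`. -/
lemma sum_range_antitone_mul_sub_nonneg {W T : ℕ → ℝ} (hW : Antitone W) (hT : ∀ m, 0 ≤ T m)
    (hT₀ : T 0 = 0) (hW₀ : ∀ m, 0 ≤ W m) (n : ℕ) :
    0 ≤ ∑ k ∈ Finset.range n, W k * (T (k + 1) - T k) := by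
  have h : W n * T n ≤ ∑ k ∈ Finset.range n, W k * (T (k + 1) - T k) := by
    induction n with
    | zero => simp [hT₀]
    | succ n ih =>
      rw [Finset.sum_range_succ]
      have := mul_le_mul_of_nonneg_right (hW n.le_succ) (hT (n + 1))
      linarith
  exact (mul_nonneg (hW₀ n) (hT n)).trans h

section Lovasz

variable {p : ℕ} {F : Finset (Fin p) → ℝ}

/-- The image under `τ` of the first `m` indices. -/
def initialImage (τ : Equiv.Perm (Fin p)) (m : ℕ) : Finset (Fin p) :=
  Finset.univ.filter fun i => (τ.symm i).val < m

lemma mem_initialImage {τ : Equiv.Perm (Fin p)} {m : ℕ} {i : Fin p} :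
    i ∈ initialImage τ m ↔ (τ.symm i).val < m := by simp [initialImage]

lemma initialImage_zero (τ : Equiv.Perm (Fin p)) : initialImage τ 0 = ∅ := by
  ext i; simp [mem_initialImage]

lemma initialImage_eq_univ (τ : Equiv.Perm (Fin p)) : initialImage τ p = Finset.univ := by
  ext i; simp [mem_initialImage]

lemma initialImage_succ (τ : Equiv.Perm (Fin p)) (k : Fin p) :
    initialImage τ (k + 1) = insert (τ k) (initialImage τ k) := by
  ext i
  rw [Finset.mem_insert, mem_initialImage, mem_initialImage, Nat.lt_succ_iff_lt_or_eq, or_comm,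
    ← Equiv.symm_apply_eq, Fin.ext_iff]

lemma apply_notMem_initialImage (τ : Equiv.Perm (Fin p)) (k : Fin p) :
    τ k ∉ initialImage τ k := by
  simp [mem_initialImage]

lemma image_Iic_eq_initialImage (τ : Equiv.Perm (Fin p)) (k : Fin p) :
    (Finset.Iic k).image τ = initialImage τ (k + 1) := by
  ext i
  simp only [Finset.mem_image, Finset.mem_Iic, mem_initialImage, Nat.lt_succ_iff, ← Fin.le_def]
  exact ⟨fun ⟨j, hj, e⟩ => by simpa [← e] using hj, fun h => ⟨_, h, by simp⟩⟩

lemma image_Iio_eq_initialImage (τ : Equiv.Perm (Fin p)) (k : Fin p) :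
    (Finset.Iio k).image τ = initialImage τ k := by
  ext i
  simp only [Finset.mem_image, Finset.mem_Iio, mem_initialImage, ← Fin.lt_def]
  exact ⟨fun ⟨j, hj, e⟩ => by simpa [← e] using hj, fun h => ⟨_, h, by simp⟩⟩

/-- The permutation that sorts the entries of `θ` by decreasing absolute value. -/
noncomputable def absSort (θ : EuclideanSpace ℝ (Fin p)) : Equiv.Perm (Fin p) := Tuple.sort fun i => -|θ i|

lemma antitone_abs_absSort (θ : EuclideanSpace ℝ (Fin p)) :
    Antitone fun k => |θ (absSort θ k)| := fun i j hij => by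
  have h := Tuple.monotone_sort (fun i => -|θ i|) hij
  simp only [Function.comp_apply] at h
  exact neg_le_neg_iff.1 h

lemma omegaInf_eq_sum (θ : EuclideanSpace ℝ (Fin p)) :
    omegaInf F θ = ∑ k : Fin p, |θ (absSort θ k)|
      * (F (initialImage (absSort θ) (k + 1)) - F (initialImage (absSort θ) k)) := by
  simp only [omegaInf, lovaszExtension, image_Iic_eq_initialImage, image_Iio_eq_initialImage]
  rfl

/-- The marginal gains of a submodular function along an ordering are dominated by the function. -/
lemma sum_marginal_le (hmono : Monotone F) (hsub : IsSubmodular F) (h₀ : F ∅ = 0)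
    (τ : Equiv.Perm (Fin p)) (A : Finset (Fin p)) :
    ∑ i ∈ A, (F (initialImage τ ((τ.symm i).val + 1)) - F (initialImage τ (τ.symm i))) ≤ F A := by
  have h₁ : ∀ k : Fin p, (if τ k ∈ A then
      F (initialImage τ (k + 1)) - F (initialImage τ k) else 0)
      ≤ F (A ∩ initialImage τ (k + 1)) - F (A ∩ initialImage τ k) := by
    intro k
    split_ifs with hk
    -- Diminishing returns: adding `τ k` to the full initial segment gains no more than adding it to
    -- the part of that segment inside `A`. The latter gains telescope.
    · have h := hsub (A ∩ initialImage τ (k + 1)) (initialImage τ k)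
      have e₁ : A ∩ initialImage τ (k + 1) ∪ initialImage τ k = initialImage τ (k + 1) := by
        rw [initialImage_succ]
        ext i
        simp only [Finset.mem_union, Finset.mem_inter, Finset.mem_insert]
        grind
      have e₂ : A ∩ initialImage τ (k + 1) ∩ initialImage τ k = A ∩ initialImage τ k := by
        rw [initialImage_succ]
        ext i
        simp only [Finset.mem_inter, Finset.mem_insert]
        grind
      rw [e₁, e₂] at h
      linarith
    · refine sub_nonneg.2 (hmono (Finset.inter_subset_inter_left ?_))
      rw [initialImage_succ]
      exact Finset.subset_insert _ _
  calc _ = ∑ i, (if i ∈ A then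
        F (initialImage τ ((τ.symm i).val + 1)) - F (initialImage τ (τ.symm i)) else 0) := by
        rw [Finset.sum_ite_mem, Finset.univ_inter]
    _ = ∑ k, (if τ k ∈ A then F (initialImage τ (k + 1)) - F (initialImage τ k) else 0) := by
        rw [← Equiv.sum_comp τ]
        simp
    _ ≤ ∑ k : Fin p, (F (A ∩ initialImage τ (k + 1)) - F (A ∩ initialImage τ k)) :=
        Finset.sum_le_sum fun k _ => h₁ k
    _ = F A := by
        rw [Fin.sum_univ_eq_sum_range
          (fun m => F (A ∩ initialImage τ (m + 1)) - F (A ∩ initialImage τ m)),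
          Finset.sum_range_sub (fun m => F (A ∩ initialImage τ m)), initialImage_zero,
          initialImage_eq_univ]
        simp [h₀]

lemma sum_abs_mul_abs_le_omegaInf (h₀ : F ∅ = 0) (θ : EuclideanSpace ℝ (Fin p))
    {s : EuclideanSpace ℝ (Fin p)} (hs : s ∈ symPolyhedron F) :
    ∑ i, |θ i| * |s i| ≤ omegaInf F θ := by
  set τ := absSort θ with hτ
  set W : ℕ → ℝ := fun k => if h : k < p then |θ (τ ⟨k, h⟩)| else 0 with hW
  -- The slack in the constraints of the polyhedron along the sorted chain; its sum against the
  -- decreasing weights `W` is the difference of the two sides.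
  set T : ℕ → ℝ := fun m => F (initialImage τ m) - ∑ i ∈ initialImage τ m, |s i| with hT
  have hWanti : Antitone W := by
    intro a b hab
    simp only [hW]
    split_ifs with hb ha ha
    · exact antitone_abs_absSort θ (Fin.mk_le_mk.2 hab)
    · exact absurd (hab.trans_lt hb) ha
    · exact abs_nonneg _
    · exact le_rfl
  have h := sum_range_antitone_mul_sub_nonneg hWanti (T := T) (fun m => sub_nonneg.2 (hs _))
    (by simp [hT, initialImage_zero, h₀])
    (fun m => by simp only [hW]; split_ifs <;> positivity) p
  rw [← Fin.sum_univ_eq_sum_range (fun k => W k * (T (k + 1) - T k))] at h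
  have e : ∀ k : Fin p, W k * (T (k + 1) - T k)
      = |θ (τ k)| * (F (initialImage τ (k + 1)) - F (initialImage τ k))
        - |θ (τ k)| * |s (τ k)| := by
    intro k
    simp only [hW, hT, k.2, dif_pos]
    rw [initialImage_succ, Finset.sum_insert (apply_notMem_initialImage τ k)]
    ring
  rw [Finset.sum_congr rfl fun k _ => e k, Finset.sum_sub_distrib, ← omegaInf_eq_sum,
    Equiv.sum_comp τ fun i => |θ i| * |s i|] at h
  linarith

lemma inner_le_omegaInf (h₀ : F ∅ = 0) (θ : EuclideanSpace ℝ (Fin p))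
    {s : EuclideanSpace ℝ (Fin p)} (hs : s ∈ symPolyhedron F) :
    inner ℝ θ s ≤ omegaInf F θ := by
  refine le_trans ?_ (sum_abs_mul_abs_le_omegaInf h₀ θ hs)
  rw [PiLp.inner_apply]
  refine Finset.sum_le_sum fun i _ => ?_
  rw [← abs_mul, mul_comm (θ i)]
  exact le_abs_self _

/-- The greedy algorithm attains the maximum of a linear form over the symmetric polyhedron. -/
lemma exists_inner_eq_omegaInf (hmono : Monotone F) (hsub : IsSubmodular F) (h₀ : F ∅ = 0)
    (θ : EuclideanSpace ℝ (Fin p)) :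
    ∃ s ∈ symPolyhedron F, inner ℝ θ s = omegaInf F θ := by
  set τ := absSort θ with hτ
  set c : Fin p → ℝ := fun i =>
    F (initialImage τ ((τ.symm i).val + 1)) - F (initialImage τ (τ.symm i)) with hc
  -- Nonnegative gains can be given the signs of `θ` without changing their absolute values, which
  -- keeps the point in the symmetric polyhedron.
  have hc₀ : ∀ i, 0 ≤ c i := fun i => by
    refine sub_nonneg.2 (hmono ?_)
    rw [initialImage_succ]
    exact Finset.subset_insert _ _
  refine ⟨WithLp.toLp 2 fun i => (if 0 ≤ θ i then 1 else -1) * c i, fun A => ?_, ?_⟩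
  · refine le_trans (le_of_eq ?_) (sum_marginal_le hmono hsub h₀ τ A)
    refine Finset.sum_congr rfl fun i _ => ?_
    rw [abs_mul, abs_of_nonneg (hc₀ i)]
    split_ifs <;> simp [hc]
  · rw [omegaInf_eq_sum, PiLp.inner_apply, ← Equiv.sum_comp τ]
    refine Finset.sum_congr rfl fun k _ => ?_
    simp only [RCLike.inner_apply, conj_trivial, hc, Equiv.symm_apply_apply]
    split_ifs with hk
    · rw [abs_of_nonneg hk]
      ring
    · rw [abs_of_neg (not_le.1 hk)]
      ring

lemma zero_mem_symPolyhedron (hmono : Monotone F) (h₀ : F ∅ = 0) :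
    (0 : EuclideanSpace ℝ (Fin p)) ∈ symPolyhedron F := fun A => by
  simpa [h₀] using hmono (Finset.empty_subset A)

lemma omegaInf_eq_iSup (hmono : Monotone F) (hsub : IsSubmodular F) (h₀ : F ∅ = 0)
    (θ : EuclideanSpace ℝ (Fin p)) :
    omegaInf F θ = ⨆ w : symPolyhedron F, inner ℝ θ (w : EuclideanSpace ℝ (Fin p)) := by
  have : Nonempty (symPolyhedron F) := ⟨⟨0, zero_mem_symPolyhedron hmono h₀⟩⟩
  refine le_antisymm ?_ (ciSup_le fun w => inner_le_omegaInf h₀ θ w.2)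
  obtain ⟨s, hs, e⟩ := exists_inner_eq_omegaInf hmono hsub h₀ θ
  rw [← e]
  refine le_ciSup (f := fun w : symPolyhedron F => inner ℝ θ (w : EuclideanSpace ℝ (Fin p)))
    ⟨omegaInf F θ, ?_⟩ ⟨s, hs⟩
  rintro _ ⟨w, rfl⟩
  exact inner_le_omegaInf h₀ θ w.2

lemma omegaInf_nonneg (hmono : Monotone F) (h₀ : F ∅ = 0) (θ : EuclideanSpace ℝ (Fin p)) :
    0 ≤ omegaInf F θ := by
  simpa using inner_le_omegaInf h₀ θ (zero_mem_symPolyhedron hmono h₀)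

lemma omegaInf_add_le (hmono : Monotone F) (hsub : IsSubmodular F) (h₀ : F ∅ = 0)
    (θ θ' : EuclideanSpace ℝ (Fin p)) :
    omegaInf F (θ + θ') ≤ omegaInf F θ + omegaInf F θ' := by
  obtain ⟨s, hs, e⟩ := exists_inner_eq_omegaInf hmono hsub h₀ (θ + θ')
  rw [← e, inner_add_left]
  exact add_le_add (inner_le_omegaInf h₀ _ hs) (inner_le_omegaInf h₀ _ hs)

lemma omegaInf_smul_le (hmono : Monotone F) (hsub : IsSubmodular F) (h₀ : F ∅ = 0)
    {c : ℝ} (hc : 0 ≤ c) (θ : EuclideanSpace ℝ (Fin p)) :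
    omegaInf F (c • θ) ≤ c * omegaInf F θ := by
  obtain ⟨s, hs, e⟩ := exists_inner_eq_omegaInf hmono hsub h₀ (c • θ)
  rw [← e, real_inner_smul_left]
  exact mul_le_mul_of_nonneg_left (inner_le_omegaInf h₀ _ hs) hc

lemma omegaInf_le_mul_norm (hmono : Monotone F) (hsub : IsSubmodular F) (h₀ : F ∅ = 0)
    (θ : EuclideanSpace ℝ (Fin p)) : omegaInf F θ ≤ F Finset.univ * ‖θ‖ := by
  obtain ⟨s, hs, e⟩ := exists_inner_eq_omegaInf hmono hsub h₀ θ
  rw [← e, PiLp.inner_apply]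
  calc ∑ i, inner ℝ (θ i) (s i) ≤ ∑ i, |s i| * ‖θ‖ := by
        refine Finset.sum_le_sum fun i _ => ?_
        refine (real_inner_le_norm _ _).trans ?_
        rw [mul_comm, Real.norm_eq_abs (s i)]
        exact mul_le_mul_of_nonneg_left (PiLp.norm_apply_le θ i) (abs_nonneg _)
    _ ≤ F Finset.univ * ‖θ‖ := by
        rw [← Finset.sum_mul]
        exact mul_le_mul_of_nonneg_right (hs _) (norm_nonneg _)

lemma abs_omegaInf_sub_le (hmono : Monotone F) (hsub : IsSubmodular F) (h₀ : F ∅ = 0)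
    (θ θ' : EuclideanSpace ℝ (Fin p)) :
    |omegaInf F θ - omegaInf F θ'| ≤ F Finset.univ * ‖θ - θ'‖ := by
  have h₁ := omegaInf_add_le hmono hsub h₀ (θ - θ') θ'
  have h₂ := omegaInf_add_le hmono hsub h₀ (θ' - θ) θ
  have h₃ := omegaInf_le_mul_norm hmono hsub h₀ (θ - θ')
  have h₄ := omegaInf_le_mul_norm hmono hsub h₀ (θ' - θ)
  rw [sub_add_cancel] at h₁ h₂
  rw [norm_sub_rev] at h₄
  rw [abs_le]
  constructor <;> linarith

lemma continuous_omegaInf (hmono : Monotone F) (hsub : IsSubmodular F) (h₀ : F ∅ = 0) :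
    Continuous (omegaInf F) := by
  have hF : 0 ≤ F Finset.univ := h₀ ▸ hmono (Finset.empty_subset _)
  have h : LipschitzWith ⟨F Finset.univ, hF⟩ (omegaInf F) :=
    LipschitzWith.of_dist_le_mul fun θ θ' => by
      rw [Real.dist_eq, dist_eq_norm]
      exact abs_omegaInf_sub_le hmono hsub h₀ θ θ'
  exact h.continuous

lemma singleton_mul_abs_le_omegaInf (hmono : Monotone F) (h₀ : F ∅ = 0)
    (θ : EuclideanSpace ℝ (Fin p)) (i : Fin p) : |θ i| * F {i} ≤ omegaInf F θ := by
  have hF : 0 ≤ F {i} := h₀ ▸ hmono (Finset.empty_subset _)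
  have hs : EuclideanSpace.single i (F {i}) ∈ symPolyhedron F := by
    intro A
    have e : ∀ j, |(EuclideanSpace.single i (F {i})) j| = if i = j then F {i} else 0 := by
      intro j
      by_cases h : i = j
      · subst h; simp [abs_of_nonneg hF]
      · simp [h, Ne.symm h]
    simp only [e, Finset.sum_ite_eq]
    split_ifs with hi
    · exact hmono (Finset.singleton_subset_iff.2 hi)
    · exact h₀ ▸ hmono (Finset.empty_subset _)
  refine le_trans ?_ (sum_abs_mul_abs_le_omegaInf h₀ θ hs)
  refine le_trans (le_of_eq ?_) (Finset.single_le_sum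
    (f := fun j => |θ j| * |(EuclideanSpace.single i (F {i})) j|)
    (fun j _ => by positivity) (Finset.mem_univ i))
  simp [abs_of_nonneg hF]

/-! ### The Gaussian width -/

lemma integrable_norm_stdGaussian :
    Integrable (fun b => ‖b‖) (stdGaussian (EuclideanSpace ℝ (Fin p))) :=
  (IsGaussian.integrable_id (μ := stdGaussian (EuclideanSpace ℝ (Fin p)))).norm

lemma integrable_omegaInf_stdGaussian (hmono : Monotone F) (hsub : IsSubmodular F) (h₀ : F ∅ = 0) :
    Integrable (omegaInf F) (stdGaussian (EuclideanSpace ℝ (Fin p))) := by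
  refine (integrable_norm_stdGaussian.const_mul (F Finset.univ)).mono'
    (continuous_omegaInf hmono hsub h₀).aestronglyMeasurable (ae_of_all _ fun b => ?_)
  rw [Real.norm_of_nonneg (omegaInf_nonneg hmono h₀ b)]
  exact omegaInf_le_mul_norm hmono hsub h₀ b

lemma gaussianWidth_symPolyhedron (hmono : Monotone F) (hsub : IsSubmodular F) (h₀ : F ∅ = 0) :
    gaussianWidth (symPolyhedron F)
      = ∫ b, omegaInf F b ∂(stdGaussian (EuclideanSpace ℝ (Fin p))) := by
  simp only [gaussianWidth, omegaInf_eq_iSup hmono hsub h₀]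

lemma integral_sq_inner_stdGaussian (x : EuclideanSpace ℝ (Fin p)) :
    ∫ b, (inner ℝ b x) ^ 2 ∂(stdGaussian (EuclideanSpace ℝ (Fin p))) = ‖x‖ ^ 2 := by
  have h := variance_dual_stdGaussian (E := EuclideanSpace ℝ (Fin p)) (innerSL ℝ x)
  rw [variance_of_integral_eq_zero (innerSL ℝ x).continuous.aemeasurable
    (integral_strongDual_stdGaussian _), innerSL_apply_norm] at h
  simpa [real_inner_comm] using h

lemma integrable_sq_inner_stdGaussian (x : EuclideanSpace ℝ (Fin p)) :
    Integrable (fun b => (inner ℝ b x) ^ 2) (stdGaussian (EuclideanSpace ℝ (Fin p))) := by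
  have h : MemLp (innerSL ℝ x) 2 (stdGaussian (EuclideanSpace ℝ (Fin p))) :=
    IsGaussian.memLp_dual _ _ _ (by simp)
  simpa [real_inner_comm] using h.integrable_sq

/-- If the width vanished, so would `omegaInf F` almost everywhere and with it a coordinate of the
Gaussian vector, which has variance one. -/
lemma gaussianWidth_pos (hp : 0 < p) (hmono : Monotone F) (hsub : IsSubmodular F) (h₀ : F ∅ = 0)
    (hF : ∀ i, 0 < F {i}) : 0 < gaussianWidth (symPolyhedron F) := by
  rw [gaussianWidth_symPolyhedron hmono hsub h₀]
  refine (integral_nonneg (omegaInf_nonneg hmono h₀)).lt_of_ne fun hcon => ?_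
  have h₁ := (integral_eq_zero_iff_of_nonneg (omegaInf_nonneg hmono h₀)
    (integrable_omegaInf_stdGaussian hmono hsub h₀)).1 hcon.symm
  set i : Fin p := ⟨0, hp⟩
  have h₂ := integral_sq_inner_stdGaussian (EuclideanSpace.single i (1 : ℝ))
  have h₃ : (fun b : EuclideanSpace ℝ (Fin p) => (inner ℝ b (EuclideanSpace.single i (1 : ℝ))) ^ 2)
      =ᵐ[stdGaussian (EuclideanSpace ℝ (Fin p))] fun _ => 0 := by
    filter_upwards [h₁] with b hb
    have h₄ := singleton_mul_abs_le_omegaInf hmono h₀ b i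
    rw [hb, Pi.zero_apply] at h₄
    have h₅ : |b i| = 0 := le_antisymm
      (le_of_mul_le_mul_right (by simpa using h₄) (hF i)) (abs_nonneg _)
    simp [EuclideanSpace.inner_single_right, abs_eq_zero.1 h₅]
  rw [integral_congr_ae h₃] at h₂
  simp at h₂

/-- The second moment of `⟨b, x⟩` is `‖x‖²`; the pointwise bound `|t| ≤ (t² / ‖x‖ + ‖x‖) / 2` plays
the role of Cauchy–Schwarz. -/
lemma integral_abs_inner_stdGaussian_le (x : EuclideanSpace ℝ (Fin p)) :
    ∫ b, |inner ℝ b x| ∂(stdGaussian (EuclideanSpace ℝ (Fin p))) ≤ ‖x‖ := by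
  rcases eq_or_ne x 0 with rfl | hx
  · simp
  have hc : 0 < ‖x‖ := norm_pos_iff.2 hx
  have hI : Integrable (fun b => ((inner ℝ b x) ^ 2 / ‖x‖ + ‖x‖) / 2)
      (stdGaussian (EuclideanSpace ℝ (Fin p))) :=
    (((integrable_sq_inner_stdGaussian x).div_const _).add (integrable_const _)).div_const 2
  have hpt : ∀ b : EuclideanSpace ℝ (Fin p),
      |inner ℝ b x| ≤ ((inner ℝ b x) ^ 2 / ‖x‖ + ‖x‖) / 2 := by
    intro b
    rw [← sq_abs, le_div_iff₀ two_pos, ← sub_nonneg]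
    have e : |inner ℝ b x| ^ 2 / ‖x‖ + ‖x‖ - |inner ℝ b x| * 2
        = (|inner ℝ b x| - ‖x‖) ^ 2 / ‖x‖ := by
      field_simp
      ring
    rw [e]
    positivity
  refine (integral_mono_of_nonneg (ae_of_all _ fun b => abs_nonneg _) hI
    (ae_of_all _ hpt)).trans (le_of_eq ?_)
  rw [integral_div, integral_add ((integrable_sq_inner_stdGaussian x).div_const _)
    (integrable_const _), integral_div, integral_sq_inner_stdGaussian]
  simp only [integral_const, probReal_univ, one_smul]
  field_simp
  ring

end Lovasz

/-! ### Output perturbation -/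

section Perturbation

variable {p : ℕ} {F : Finset (Fin p) → ℝ} {ℓ : ℝ → ℝ → ℝ} {L R₂ : ℝ}
  {Dist : Measure (DataPoint p)}

lemma trueRisk_eq [IsProbabilityMeasure Dist] (hint : ∀ θ, Integrable (glmLoss ℓ θ) Dist)
    (n : ℕ) (lam : ℝ) (θ : EuclideanSpace ℝ (Fin p)) :
    trueRisk n ℓ F lam Dist θ = (∫ d, glmLoss ℓ θ d ∂Dist) + lam / n * omegaInf F θ := by
  rw [trueRisk, integral_add (hint θ) (integrable_const _)]
  simp

lemma integrable_abs_inner_prod [IsProbabilityMeasure Dist] (hR : ∀ᵐ d ∂Dist, ‖d.1‖ ≤ R₂) :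
    Integrable (fun z : EuclideanSpace ℝ (Fin p) × DataPoint p => |inner ℝ z.1 z.2.1|)
      ((stdGaussian (EuclideanSpace ℝ (Fin p))).prod Dist) := by
  refine Integrable.mono' (g := fun z => ‖z.1‖ * R₂)
    ((integrable_norm_stdGaussian.mul_const R₂).comp_fst Dist) ?_ ?_
  · exact (Continuous.abs (by fun_prop)).aestronglyMeasurable
  · filter_upwards [Measure.quasiMeasurePreserving_snd.ae hR] with z hz
    rw [Real.norm_eq_abs, abs_abs]
    exact (abs_real_inner_le_norm _ _).trans (mul_le_mul_of_nonneg_left hz (norm_nonneg _))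

lemma integrable_integral_abs_inner [IsProbabilityMeasure Dist] (hR : ∀ᵐ d ∂Dist, ‖d.1‖ ≤ R₂) :
    Integrable (fun b => ∫ d, |inner ℝ b d.1| ∂Dist) (stdGaussian (EuclideanSpace ℝ (Fin p))) :=
  (integrable_abs_inner_prod hR).integral_prod_left

/-- Averaging over `b` with `x` fixed keeps the bound free of the dimension; estimating `|⟨b, x⟩|`
by `‖b‖ ‖x‖` would cost a factor of order `√p`. -/
lemma integral_integral_abs_inner_le [IsProbabilityMeasure Dist]
    (hR : ∀ᵐ d ∂Dist, ‖d.1‖ ≤ R₂) :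
    ∫ b, ∫ d, |inner ℝ b d.1| ∂Dist ∂(stdGaussian (EuclideanSpace ℝ (Fin p))) ≤ R₂ := by
  rw [integral_integral_swap (integrable_abs_inner_prod hR)]
  refine (integral_mono_ae (integrable_abs_inner_prod hR).integral_prod_right
    (integrable_const R₂) ?_).trans (by simp)
  filter_upwards [hR] with d hd
  exact (integral_abs_inner_stdGaussian_le d.1).trans hd

/-- The loss in true risk caused by a perturbation. -/
lemma trueRisk_add_smul_le (hmono : Monotone F) (hsub : IsSubmodular F) (h₀ : F ∅ = 0)
    (hℓ : ∀ y u v, |ℓ u y - ℓ v y| ≤ L * |u - v|) [IsProbabilityMeasure Dist]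
    (hR : ∀ᵐ d ∂Dist, ‖d.1‖ ≤ R₂) (hint : ∀ θ, Integrable (glmLoss ℓ θ) Dist) (n : ℕ)
    {lam σ : ℝ} (hlam : 0 ≤ lam) (hσ : 0 ≤ σ) (θ b : EuclideanSpace ℝ (Fin p)) :
    trueRisk n ℓ F lam Dist (θ + σ • b) ≤ trueRisk n ℓ F lam Dist θ
      + (L * σ * ∫ d, |inner ℝ b d.1| ∂Dist) + lam / n * σ * omegaInf F b := by
  rw [trueRisk_eq hint, trueRisk_eq hint]
  have hI : Integrable (fun d : DataPoint p => |inner ℝ b d.1|) Dist := by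
    refine Integrable.of_bound (Continuous.abs (by fun_prop)).aestronglyMeasurable (‖b‖ * R₂) ?_
    filter_upwards [hR] with d hd
    rw [Real.norm_eq_abs, abs_abs]
    exact (abs_real_inner_le_norm _ _).trans (mul_le_mul_of_nonneg_left hd (norm_nonneg _))
  have h₁ : ∫ d, glmLoss ℓ (θ + σ • b) d ∂Dist
      ≤ (∫ d, glmLoss ℓ θ d ∂Dist) + L * σ * ∫ d, |inner ℝ b d.1| ∂Dist := by
    rw [← integral_const_mul, ← integral_add (hint θ) (hI.const_mul _)]
    refine integral_mono (hint _) ((hint θ).add (hI.const_mul _)) fun d => ?_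
    have h := (le_abs_self _).trans (abs_glmLoss_sub_le hℓ (θ + σ • b) θ d)
    rw [add_sub_cancel_left, real_inner_smul_left, abs_mul, abs_of_nonneg hσ, ← mul_assoc] at h
    simp only
    linarith
  have h₂ : omegaInf F (θ + σ • b) ≤ omegaInf F θ + σ * omegaInf F b :=
    (omegaInf_add_le hmono hsub h₀ _ _).trans
      (add_le_add_right (omegaInf_smul_le hmono hsub h₀ hσ b) _)
  have h₃ := mul_le_mul_of_nonneg_left h₂ (div_nonneg hlam (Nat.cast_nonneg n))
  linarith

lemma abs_trueRisk_sub_le (hmono : Monotone F) (hsub : IsSubmodular F) (h₀ : F ∅ = 0)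
    (hL : 0 < L) (hℓ : ∀ y u v, |ℓ u y - ℓ v y| ≤ L * |u - v|) [IsProbabilityMeasure Dist]
    (hR : ∀ᵐ d ∂Dist, ‖d.1‖ ≤ R₂) (hint : ∀ θ, Integrable (glmLoss ℓ θ) Dist) (n : ℕ)
    {lam : ℝ} (hlam : 0 ≤ lam) (θ θ' : EuclideanSpace ℝ (Fin p)) :
    |trueRisk n ℓ F lam Dist θ - trueRisk n ℓ F lam Dist θ'|
      ≤ (L * R₂ + lam / n * F Finset.univ) * ‖θ - θ'‖ := by
  rw [trueRisk_eq hint, trueRisk_eq hint, add_sub_add_comm, ← mul_sub, add_mul]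
  refine (abs_add_le _ _).trans (add_le_add (integral_glmLoss_sub_le hL hℓ hR hint θ θ') ?_)
  rw [abs_mul, abs_of_nonneg (div_nonneg hlam (Nat.cast_nonneg n)), mul_assoc]
  exact mul_le_mul_of_nonneg_left (abs_omegaInf_sub_le hmono hsub h₀ θ θ')
    (div_nonneg hlam (Nat.cast_nonneg n))

lemma continuous_trueRisk (hmono : Monotone F) (hsub : IsSubmodular F) (h₀ : F ∅ = 0)
    (hL : 0 < L) (hR₂ : 0 < R₂) (hℓ : ∀ y u v, |ℓ u y - ℓ v y| ≤ L * |u - v|)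
    [IsProbabilityMeasure Dist] (hR : ∀ᵐ d ∂Dist, ‖d.1‖ ≤ R₂)
    (hint : ∀ θ, Integrable (glmLoss ℓ θ) Dist) (n : ℕ) (lam : ℝ) :
    Continuous (trueRisk n ℓ F lam Dist) := by
  simp only [funext (trueRisk_eq (F := F) hint n lam)]
  exact (continuous_integral_glmLoss hL hR₂ hℓ hR hint).add
    (continuous_const.mul (continuous_omegaInf hmono hsub h₀))

lemma integrable_trueRisk_add_smul (hmono : Monotone F) (hsub : IsSubmodular F) (h₀ : F ∅ = 0)
    (hL : 0 < L) (hR₂ : 0 < R₂) (hℓ : ∀ y u v, |ℓ u y - ℓ v y| ≤ L * |u - v|)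
    [IsProbabilityMeasure Dist] (hR : ∀ᵐ d ∂Dist, ‖d.1‖ ≤ R₂)
    (hint : ∀ θ, Integrable (glmLoss ℓ θ) Dist) (n : ℕ) {lam : ℝ} (hlam : 0 ≤ lam) (σ : ℝ)
    (θ : EuclideanSpace ℝ (Fin p)) :
    Integrable (fun b => trueRisk n ℓ F lam Dist (θ + σ • b))
      (stdGaussian (EuclideanSpace ℝ (Fin p))) := by
  refine Integrable.mono' (g := fun b => |trueRisk n ℓ F lam Dist θ|
      + (L * R₂ + lam / n * F Finset.univ) * |σ| * ‖b‖)
    ((integrable_const _).add (integrable_norm_stdGaussian.const_mul _))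
    ((continuous_trueRisk hmono hsub h₀ hL hR₂ hℓ hR hint n lam).comp
      (by fun_prop)).aestronglyMeasurable (ae_of_all _ fun b => ?_)
  have h := abs_trueRisk_sub_le hmono hsub h₀ hL hℓ hR hint n hlam (θ + σ • b) θ
  rw [add_sub_cancel_left, norm_smul, Real.norm_eq_abs, ← mul_assoc] at h
  rw [Real.norm_eq_abs]
  linarith [abs_sub_abs_le_abs_sub (trueRisk n ℓ F lam Dist (θ + σ • b))
    (trueRisk n ℓ F lam Dist θ)]

/-- The expected loss in true risk caused by Gaussian output perturbation. -/
lemma integral_trueRisk_add_smul_le (hmono : Monotone F) (hsub : IsSubmodular F) (h₀ : F ∅ = 0)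
    (hL : 0 < L) (hR₂ : 0 < R₂) (hℓ : ∀ y u v, |ℓ u y - ℓ v y| ≤ L * |u - v|)
    [IsProbabilityMeasure Dist] (hR : ∀ᵐ d ∂Dist, ‖d.1‖ ≤ R₂)
    (hint : ∀ θ, Integrable (glmLoss ℓ θ) Dist) (n : ℕ) {lam σ : ℝ} (hlam : 0 ≤ lam)
    (hσ : 0 ≤ σ) (θ : EuclideanSpace ℝ (Fin p)) :
    ∫ b, trueRisk n ℓ F lam Dist (θ + σ • b) ∂(stdGaussian (EuclideanSpace ℝ (Fin p)))
      ≤ trueRisk n ℓ F lam Dist θ + L * σ * R₂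
        + lam / n * σ * gaussianWidth (symPolyhedron F) := by
  have hI₁ := (integrable_integral_abs_inner hR).const_mul (L * σ)
  have hI₂ := (integrable_omegaInf_stdGaussian hmono hsub h₀).const_mul (lam / n * σ)
  have hI₃ : Integrable (fun b => trueRisk n ℓ F lam Dist θ
      + (L * σ * ∫ d, |inner ℝ b d.1| ∂Dist)) (stdGaussian (EuclideanSpace ℝ (Fin p))) :=
    (integrable_const _).add hI₁
  have hI₄ : Integrable (fun b => trueRisk n ℓ F lam Dist θ
      + (L * σ * ∫ d, |inner ℝ b d.1| ∂Dist) + lam / n * σ * omegaInf F b)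
      (stdGaussian (EuclideanSpace ℝ (Fin p))) := hI₃.add hI₂
  refine (integral_mono (integrable_trueRisk_add_smul hmono hsub h₀ hL hR₂ hℓ hR hint n hlam σ θ)
    hI₄ (trueRisk_add_smul_le hmono hsub h₀ hℓ hR hint n hlam hσ θ)).trans ?_
  rw [integral_add hI₃ hI₂, integral_add (integrable_const _) hI₁, integral_const_mul,
    integral_const_mul, ← gaussianWidth_symPolyhedron hmono hsub h₀]
  simp only [integral_const, probReal_univ, one_smul]
  have := mul_le_mul_of_nonneg_left (integral_integral_abs_inner_le hR)
    (mul_nonneg hL.le hσ)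
  linarith

end Perturbation

end SparsePrivateERM

/-! ### The excess risk bound. -/

open MeasureTheory SparsePrivateERM in
theorem theorem1 :
    ∃ C : ℝ, 0 < C ∧
      ∀ (p n : ℕ) (_ : 0 < p) (_ : 0 < n)
        -- the set function
        (F : Finset (Fin p) → ℝ) (_ : Monotone F) (_ : IsSubmodular F)
        (_ : F ∅ = 0) (_ : ∀ i, 0 < F {i})
        -- the loss, the data distribution and the domain of the parameter
        (ℓ : ℝ → ℝ → ℝ) (L R₂ : ℝ) (_ : 0 < L) (_ : 0 < R₂)
        (_ : ∀ y u v, |ℓ u y - ℓ v y| ≤ L * |u - v|)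
        (Dist : Measure (DataPoint p)) (_ : IsProbabilityMeasure Dist)
        (_ : ∀ᵐ d ∂Dist, ‖d.1‖ ≤ R₂)
        (_ : ∀ θ, Integrable (glmLoss ℓ θ) Dist)
        (Θ : Set (EuclideanSpace ℝ (Fin p))) (B : ℝ)
        -- the privacy parameters and the confidence level
        (ε δ α : ℝ) (_ : 0 < ε) (_ : 0 < δ) (_ : δ ≤ 1) (_ : 0 < α) (_ : α < 1)
        -- the Gaussian width, the regularization parameter and the noise level
        (G lam σ : ℝ) (_ : G = gaussianWidth (symPolyhedron F))
        (_ : lam = L * R₂ * √n / G)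
        (_ : σ = 4 * L * R₂ * √(Real.log (1 / δ) + ε) / (lam * ε))
        -- a minimizer of the true risk
        (θstar : EuclideanSpace ℝ (Fin p))
        (_ : IsArgmin (trueRisk n ℓ F lam Dist) Θ θstar) (_ : ‖θstar‖ ≤ B),
        ∃ E : Set (Fin n → DataPoint p), MeasurableSet E ∧
          ENNReal.ofReal (1 - α) ≤ Measure.pi (fun _ : Fin n => Dist) E ∧
          ∀ D ∈ E, ∀ θhat, IsArgmin (empRisk ℓ F lam D) Θ θhat → ‖θhat‖ ≤ B →
            Integrable
              (fun b => trueRisk n ℓ F lam Dist (θhat + b) - trueRisk n ℓ F lam Dist θstar)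
              (isotropicGaussian p σ) ∧
            ∫ b, (trueRisk n ℓ F lam Dist (θhat + b) - trueRisk n ℓ F lam Dist θstar)
                ∂(isotropicGaussian p σ)
              ≤ C * (1 + B * ε * √(Real.log (2 / α)) / (G * √(Real.log (1 / δ) + ε)))
                  * (L * R₂ * G * √(Real.log (1 / δ) + ε) / (ε * √n)) := by
  -- The noise costs at most 4 units of the rate through the loss and 4 through the regularizer; the
  -- deviation constant 6 fits under the same 8.
  refine ⟨8, by norm_num, ?_⟩
  intro p n hp hn F hmono hsub h₀ hF ℓ L R₂ hL hR₂ hℓ Dist hDist hR hint Θ B ε δ α hε hδ hδ₁ hα hα₁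
    G lam σ hG hlam hσ θstar hstar hstarB
  have hn' : (0 : ℝ) < n := by exact_mod_cast hn
  have hsn : 0 < √(n : ℝ) := Real.sqrt_pos.2 hn'
  have hsn₁ : 1 ≤ √(n : ℝ) := Real.one_le_sqrt.2 (by exact_mod_cast hn)
  have hsq : √(n : ℝ) ^ 2 = n := Real.sq_sqrt hn'.le
  have hG₀ : 0 < G := hG ▸ gaussianWidth_pos hp hmono hsub h₀ hF
  have hB₀ : 0 ≤ B := (norm_nonneg _).trans hstarB
  have hs : 0 < √(Real.log (1 / δ) + ε) := by
    refine Real.sqrt_pos.2 (add_pos_of_nonneg_of_pos (Real.log_nonneg ?_) hε)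
    rwa [le_div_iff₀ hδ, one_mul]
  set s := √(Real.log (1 / δ) + ε)
  have hlam₀ : 0 < lam := by rw [hlam]; positivity
  have hσ₀ : 0 < σ := by rw [hσ]; positivity
  obtain ⟨E, hEm, hE, hdev⟩ := exists_event_forall_excess_loss_le hL hR₂ hℓ hR hint hn hα hα₁ hstarB
  refine ⟨E, hEm, hE, fun D hD θhat hhat hhatB => ?_⟩
  have hI := integrable_trueRisk_add_smul (F := F) hmono hsub h₀ hL hR₂ hℓ hR hint n hlam₀.le σ θhat
  have hcont := continuous_trueRisk hmono hsub h₀ hL hR₂ hℓ hR hint n lam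
  have hm : AEMeasurable (fun b : EuclideanSpace ℝ (Fin p) => σ • b)
      (ProbabilityTheory.stdGaussian (EuclideanSpace ℝ (Fin p))) := by fun_prop
  have hasm : AEStronglyMeasurable
      (fun b => trueRisk n ℓ F lam Dist (θhat + b) - trueRisk n ℓ F lam Dist θstar)
      (isotropicGaussian p σ) :=
    ((hcont.comp (continuous_const.add continuous_id)).sub continuous_const).aestronglyMeasurable
  refine ⟨(integrable_map_measure hasm hm).2 (hI.sub (integrable_const _)), ?_⟩
  have hnoise := integral_trueRisk_add_smul_le hmono hsub h₀ hL hR₂ hℓ hR hint n hlam₀.le hσ₀.le θhat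
  rw [isotropicGaussian, integral_map hm hasm, integral_sub hI (integrable_const _)]
  simp only [integral_const, probReal_univ, one_smul]
  have hgen : trueRisk n ℓ F lam Dist θhat - trueRisk n ℓ F lam Dist θstar
      ≤ 6 * (L * R₂ * B * √(Real.log (2 / α)) / √n) := by
    -- The regularizer enters the true and the empirical excess risk identically, so their
    -- difference is exactly the deviation of the losses.
    have h₁ := hdev D hD θhat hhatB
    have h₂ := hhat.2 θstar hstar.1
    simp only [empRisk] at h₂
    rw [trueRisk_eq hint, trueRisk_eq hint]
    linarith
  have hσ' : σ = 4 * G * s / (√n * ε) := by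
    rw [hσ, hlam]
    field_simp
  have hrate₁ : L * σ * R₂ = 4 * (L * R₂ * G * s / (ε * √n)) := by
    rw [hσ']
    field_simp
  have hrate₂ : lam / n * σ * G ≤ 4 * (L * R₂ * G * s / (ε * √n)) := by
    -- The regularizer's share is smaller than the loss's by the factor `√n`, since `lam` is of
    -- order `√n`.
    have e : lam / n * σ * G = 4 * (L * R₂ * G * s / (ε * √n)) / √n := by
      rw [hσ', hlam]
      field_simp
      exact hsq
    rw [e]
    exact div_le_self (by positivity) hsn₁
  have hrate₃ : 8 * (1 + B * ε * √(Real.log (2 / α)) / (G * s)) * (L * R₂ * G * s / (ε * √n))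
      = 8 * (L * R₂ * G * s / (ε * √n)) + 8 * (L * R₂ * B * √(Real.log (2 / α)) / √n) := by
    field_simp
  have hpos : 0 ≤ L * R₂ * B * √(Real.log (2 / α)) / √n := by positivity
  rw [hrate₃]
  rw [← hG] at hnoise
  linarith
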